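/- Write $S^{2n-1}$ for the unit sphere of $\mathbb{C}^n$. An automorphism of $S^{2n-1}$ is a bijection of $S^{2n-1}$ given by an invertible linear fractional map of $\mathbb{C}^n$ without poles on $S^{2n-1}$. Two sphere maps $H_1,H_2\colon S^{2n-1}\to S^{2N-1}$ are equivalent if $H_2=\psi'\circ H_1\circ\psi^{-1}$ on $S^{2n-1}$ for some automorphisms $\psi$ of $S^{2n-1}$ and $\psi'$ of $S^{2N-1}$. Let $N\ge 4$ and let $(z,w)$ be the coordinates of $\mathbb{C}^2$. Define rational maps $F^1_N,F^2_N$ from $\mathbb{C}^2$ to $\mathbb{C}^N$ as follows. (1) For $N=4$, $F^1_4=(f_1,f_2,f_3,g)/\delta$ with $$\begin{aligned} f_1&=6\bigl((19w^2+40w+13)z+6(w-1)z^2-3(w+1)(w-1)^2\bigr),\\ f_2&=36z^2(3w+2z+3),\qquad f_3=-6i(w-1)(3w+2z+3)(w+3z-1),\\ g&=25+111w-6(w^2+4w-5)z+207w^2+89w^3,\\ \delta&=169+183w-6(w^2+4w-5)z+63w^2+17w^3. \end{aligned}$$ For $N\ge5$, $F^1_N=(f_1,f_2,f_3,f_4,0,\dots,0,g)/\delta$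 with $$\begin{aligned} f_1&=2\sqrt5\bigl((1+8w-w^2)z+2(w-1)z^2-(w+1)(w-1)^2\bigr),\\ f_2&=4\sqrt5\,z^2(w+2z+1),\qquad f_3=2i(1-w)(w+2z+1)(w+5z-1),\\ f_4&=-4(w-1)^2(w+2z+1),\\ g&=\sqrt5\bigl(9-9w+2(w^2-4w+3)z+15w^2+w^3\bigr),\\ \delta&=\sqrt5\bigl(17-9w+2(w^2-4w+3)z+7w^2+w^3\bigr). \end{aligned}$$ (2) For all $N\ge4$, $F^2_N=(f_1,f_2,f_3,0,\dots,0,g)/\delta$ (no zeros if $N=4$) with $$\begin{aligned} f_1&=z(w^2-w+4z^2+4),\qquad f_2=2w\bigl((w-1)^2+z^2\bigr),\qquad f_3=\sqrt{15}\,i(1-w)zw,\\ g&=(5w-1)z^2+(w+1)^2,\qquad \delta=5-2w+w^2+(w+3)z^2. \end{aligned}$$ Then each of $F^1_N$ and $F^2_N$ is a rational map of degree $3$ (the maximal degree of numerators and denominator in lowest terms), has no pole on $S^3$ and maps $S^3$ into $S^{2N-1}$, and it is not equivalent to any (holomorphic) polynomial map $\mathbb{C}^2\to\mathbb{C}^N$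 that maps $S^3$ into $S^{2N-1}$. -/

import Mathlib

/-- Complex Euclidean space `ℂⁿ` with its Hermitian norm. -/
abbrev CSpace (n : ℕ) : Type := EuclideanSpace ℂ (Fin n)

/-- The unit sphere `S^{2n-1}` in `ℂⁿ`. -/
def unitSphere (n : ℕ) : Set (CSpace n) := Metric.sphere 0 1

/-- `F` agrees on the unit sphere of `ℂⁿ` with a rational map `(p₁, …, p_N) / q` in lowest terms,
without poles on the sphere, and `d` is the maximal degree of the numerators and the
denominator. -/
def IsRationalOfDegree {n N : ℕ} (F : CSpace n → CSpace N) (d : ℕ) : Prop :=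
  ∃ (p : Fin N → MvPolynomial (Fin n) ℂ) (q : MvPolynomial (Fin n) ℂ),
    (∀ r : MvPolynomial (Fin n) ℂ, (∀ j, r ∣ p j) → r ∣ q → IsUnit r) ∧
    (∀ Z ∈ unitSphere n, MvPolynomial.eval (fun i => Z i) q ≠ 0 ∧
      ∀ j, F Z j =
        MvPolynomial.eval (fun i => Z i) (p j) / MvPolynomial.eval (fun i => Z i) q) ∧
    max (Finset.univ.sup fun j => (p j).totalDegree) q.totalDegree = d

/-- `P` is a (holomorphic) polynomial map `ℂⁿ → ℂᴺ`. -/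
def IsPolynomialMap {n N : ℕ} (P : CSpace n → CSpace N) : Prop :=
  ∃ p : Fin N → MvPolynomial (Fin n) ℂ, ∀ Z j, P Z j = MvPolynomial.eval (fun i => Z i) (p j)

/-- `ψ` restricts to an automorphism of the unit sphere of `ℂⁿ`: a bijection of the sphere given
by an invertible linear fractional map `Z ↦ (A Z + b) / (c · Z + d)` without poles on the sphere. -/
def IsSphereAut {n : ℕ} (ψ : CSpace n → CSpace n) : Prop :=
  Set.BijOn ψ (unitSphere n) (unitSphere n) ∧
  ∃ (A : Matrix (Fin n) (Fin n) ℂ) (b c : Fin n → ℂ) (d : ℂ),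
    (Matrix.fromBlocks A (Matrix.of fun i (_ : Fin 1) => b i)
      (Matrix.of fun (_ : Fin 1) j => c j) (Matrix.of fun (_ _ : Fin 1) => d)).det ≠ 0 ∧
    ∀ Z ∈ unitSphere n, (∑ k, c k * Z k) + d ≠ 0 ∧
      ∀ j, ψ Z j = ((∑ k, A j k * Z k) + b j) / ((∑ k, c k * Z k) + d)

/-- Spherical equivalence `H₂ = ψ' ∘ H₁ ∘ ψ⁻¹` of two sphere maps; as `ψ` is a bijection of the
source sphere, this is the identity `H₂ ∘ ψ = ψ' ∘ H₁` on that sphere. -/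
def SphereEquivalent {n N : ℕ} (H₁ H₂ : CSpace n → CSpace N) : Prop :=
  ∃ (ψ : CSpace n → CSpace n) (ψ' : CSpace N → CSpace N), IsSphereAut ψ ∧ IsSphereAut ψ' ∧
    ∀ Z ∈ unitSphere n, H₂ (ψ Z) = ψ' (H₁ Z)

/-- The vector `(f₁, …, f_k, 0, …, 0, g) / δ` of `ℂᴺ`, for a list `f = [f₁, …, f_k]` of length
`k < N`. -/
noncomputable def paddedQuotient (N : ℕ) (f : List ℂ) (g δ : ℂ) : CSpace N :=
  WithLp.toLp 2 fun j => if (j : ℕ) + 1 = N then g / δ else f.getD j 0 / δ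

/-- The first map, in the target dimension `N = 4`. -/
noncomputable def mapF1Four (Z : CSpace 2) : CSpace 4 :=
  let z : ℂ := Z 0
  let w : ℂ := Z 1
  paddedQuotient 4
    [6 * ((19 * w ^ 2 + 40 * w + 13) * z + 6 * (w - 1) * z ^ 2 - 3 * (w + 1) * (w - 1) ^ 2),
     36 * z ^ 2 * (3 * w + 2 * z + 3),
     -6 * Complex.I * (w - 1) * (3 * w + 2 * z + 3) * (w + 3 * z - 1)]
    (25 + 111 * w - 6 * (w ^ 2 + 4 * w - 5) * z + 207 * w ^ 2 + 89 * w ^ 3)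
    (169 + 183 * w - 6 * (w ^ 2 + 4 * w - 5) * z + 63 * w ^ 2 + 17 * w ^ 3)

/-- The first map, in the target dimensions `N ≥ 5`. -/
noncomputable def mapF1Large (N : ℕ) (Z : CSpace 2) : CSpace N :=
  let z : ℂ := Z 0
  let w : ℂ := Z 1
  let r : ℂ := (Real.sqrt 5 : ℝ)
  paddedQuotient N
    [2 * r * ((1 + 8 * w - w ^ 2) * z + 2 * (w - 1) * z ^ 2 - (w + 1) * (w - 1) ^ 2),
     4 * r * z ^ 2 * (w + 2 * z + 1),
     2 * Complex.I * (1 - w) * (w + 2 * z + 1) * (w + 5 * z - 1),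
     -4 * (w - 1) ^ 2 * (w + 2 * z + 1)]
    (r * (9 - 9 * w + 2 * (w ^ 2 - 4 * w + 3) * z + 15 * w ^ 2 + w ^ 3))
    (r * (17 - 9 * w + 2 * (w ^ 2 - 4 * w + 3) * z + 7 * w ^ 2 + w ^ 3))

/-- The first map `F¹_N`, for `N ≥ 4`. -/
noncomputable def mapF1 : (N : ℕ) → CSpace 2 → CSpace N
  | 4 => mapF1Four
  | N => mapF1Large N

/-- The second map `F²_N`, for `N ≥ 4`. -/
noncomputable def mapF2 (N : ℕ) (Z : CSpace 2) : CSpace N :=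
  let z : ℂ := Z 0
  let w : ℂ := Z 1
  let r : ℂ := (Real.sqrt 15 : ℝ)
  paddedQuotient N
    [z * (w ^ 2 - w + 4 * z ^ 2 + 4),
     2 * w * ((w - 1) ^ 2 + z ^ 2),
     r * Complex.I * (1 - w) * z * w]
    ((5 * w - 1) * z ^ 2 + (w + 1) ^ 2)
    (5 - 2 * w + w ^ 2 + (w + 3) * z ^ 2)

/-! Suppose that `p / q`, in lowest terms, is equivalent to a polynomial map `P`, so that `P ∘ ψ = φ
∘ (p / q)` on the sphere. The left side has a power of `l` as denominator, where `l` is the affine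
denominator of `ψ`. On the right the numerators and the denominator are the image of `(p, q)` under
the invertible matrix of `φ`, so they have no common factor, and the denominator is a linear
combination `lam` of the `p j` and `q`. Polynomial identities on the sphere hold everywhere, so
`lam` divides a power of the irreducible (or constant) `l`, and `lam = k * l ^ m`. Counting degrees
gives `m ≥ deg q` unless `l` is constant. Since `l` has no zero on the sphere, it has none in the
closed ball.

For the three cubic maps, `deg q = 3` leaves two cases: the span of the components and the
denominator contains `1`, or it contains `(1 + a z + b w) ^ 3` with `|a|² + |b|² < 1`. The span is a
proper subspace of the ten-dimensional space of cubics, and the linear relations defining it turn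
into polynomial equations for `a` and `b` without admissible solution.

`exists_combination_eq_affine_pow` is the general obstruction; `sphereMap_not_equivalent_polynomial`
reduces everything to computations with coefficients. -/

/-! ### Polynomials on the sphere, divisibility and constant matrices -/

open MvPolynomial in
/-- Two polynomials in two variables which agree on the unit sphere of `ℂ²` are equal. -/
theorem MvPolynomial.eq_of_eval_eq_on_unitSphere {p q : MvPolynomial (Fin 2) ℂ}
    (h : ∀ Z ∈ unitSphere 2, eval (fun i => Z i) p = eval (fun i => Z i) q) : p = q := by
  have hball : (Metric.ball (0 : ℂ) 1).Infinite :=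
    infinite_of_mem_nhds (0 : ℂ) (Metric.ball_mem_nhds _ one_pos)
  have key : ∀ w ∈ Metric.ball (0 : ℂ) 1, ∀ z : ℂ, eval ![z, w] p = eval ![z, w] q := by
    intro w hw z
    have hw1 : ‖w‖ < 1 := by simpa using hw
    have hr : 0 < 1 - ‖w‖ ^ 2 := by nlinarith [norm_nonneg w]
    -- The slice of the sphere at height `w` is this circle; it is connected and contains `x ≠ -x`,
    -- hence infinite.
    have hinf : (Metric.sphere (0 : ℂ) (Real.sqrt (1 - ‖w‖ ^ 2))).Infinite := by
      refine (isPreconnected_sphere (by simp) 0 _).infinite_of_nontrivial ?_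
      exact (NormedSpace.sphere_nonempty.2 (Real.sqrt_nonneg _)).elim fun x hx =>
        ⟨x, hx, -x, by simpa using hx, fun hxx => by
          have hx0 : x = 0 := self_eq_neg.1 hxx
          have := Real.sqrt_pos.2 hr
          simp [hx0] at hx
          linarith⟩
    have ev : ∀ (r : MvPolynomial (Fin 2) ℂ) (x : ℂ),
        Polynomial.eval x (aeval ![Polynomial.X, Polynomial.C w] r) = eval ![x, w] r := by
      intro r x
      induction r using MvPolynomial.induction_on with
      | C a => simp
      | add a b ha hb => simp [ha, hb]
      | mul_X a i ha => fin_cases i <;> simp [ha]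
    have := Polynomial.eq_of_infinite_eval_eq
      (aeval ![Polynomial.X, Polynomial.C w] p) (aeval ![Polynomial.X, Polynomial.C w] q)
      (hinf.mono fun x hx => ?_)
    · rw [← ev, ← ev, this]
    · have hx' : ‖x‖ = Real.sqrt (1 - ‖w‖ ^ 2) := by simpa using hx
      have hmem : (WithLp.toLp 2 ![x, w] : CSpace 2) ∈ unitSphere 2 := by
        simp [unitSphere, EuclideanSpace.norm_eq, Fin.sum_univ_two, hx', Real.sq_sqrt hr.le]
      simpa [ev] using h _ hmem
  refine funext_set ![Set.univ, Metric.ball 0 1] ?_ fun x hx => ?_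
  · intro i
    fin_cases i
    · exact Set.infinite_univ
    · exact hball
  · have hx1 := hx 1 trivial
    have : x = ![x 0, x 1] := by ext i; fin_cases i <;> rfl
    rw [this]
    exact key _ hx1 _

/-- Clearing denominators when fractions of affine forms with a common denominator are substituted
into a polynomial. -/
theorem MvPolynomial.exists_eval_div_mul_pow {n : ℕ} {σ : Type*} (P : MvPolynomial (Fin n) ℂ)
    {L : Fin n → MvPolynomial σ ℂ} {l : MvPolynomial σ ℂ} (hL : ∀ i, (L i).totalDegree ≤ 1)
    (hl : l.totalDegree ≤ 1) :
    ∃ (D : ℕ) (G : MvPolynomial σ ℂ), G.totalDegree ≤ D ∧ ∀ Z : σ → ℂ, eval Z l ≠ 0 →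
      eval Z G = eval (fun i => eval Z (L i) / eval Z l) P * eval Z l ^ D := by
  have hpow : ∀ m, (l ^ m).totalDegree ≤ m := fun m =>
    (totalDegree_pow _ _).trans (by simpa using Nat.mul_le_mul_left m hl)
  induction P using MvPolynomial.induction_on with
  | C a => exact ⟨0, C a, by simp, by simp⟩
  | add a b ha hb =>
    obtain ⟨D, G, hGd, hG⟩ := ha
    obtain ⟨E, H, hHd, hH⟩ := hb
    refine ⟨D + E, G * l ^ E + H * l ^ D, ?_, fun Z hZ => ?_⟩
    · refine (totalDegree_add _ _).trans (max_le ?_ ?_)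
      · exact (totalDegree_mul _ _).trans (add_le_add hGd (hpow E))
      · rw [add_comm D E]
        exact (totalDegree_mul _ _).trans (add_le_add hHd (hpow D))
    · simp only [map_add, map_mul, map_pow, hG Z hZ, hH Z hZ]
      ring
  | mul_X a i ha =>
    obtain ⟨D, G, hGd, hG⟩ := ha
    refine ⟨D + 1, G * L i, (totalDegree_mul _ _).trans (add_le_add hGd (hL i)), fun Z hZ => ?_⟩
    simp only [map_mul, hG Z hZ, eval_X]
    field_simp
    ring

/-- In a unique factorization domain, a common divisor of all multiples `v i * y` of `y` divides
`y` when the `v i` have no common factor. -/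
theorem dvd_of_forall_dvd_mul {R ι : Type*} [CommRing R] [IsDomain R]
    [UniqueFactorizationMonoid R] [Fintype ι] {v : ι → R}
    (hv : ∀ r, (∀ i, r ∣ v i) → IsUnit r) {x y : R} (h : ∀ i, x ∣ v i * y) : x ∣ y := by
  classical
  let : NormalizedGCDMonoid R := (inferInstance : Nonempty (NormalizedGCDMonoid R)).some
  have h1 : x ∣ Finset.univ.gcd fun i => v i * y := Finset.dvd_gcd fun i _ => h i
  have h2 := h1.trans (Finset.gcd_mul_right' Finset.univ v y).dvd
  exact (hv _ fun i => Finset.gcd_dvd (Finset.mem_univ i)).dvd_mul_left.1 h2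

/-- A vector of polynomials is recovered from its image under an invertible constant matrix. -/
theorem MvPolynomial.inv_map_mulVec_map_mulVec {σ ι : Type*} [Fintype ι] [DecidableEq ι]
    (M : Matrix ι ι ℂ) (hM : M.det ≠ 0) (v : ι → MvPolynomial σ ℂ) :
    (M⁻¹.map (C : ℂ →+* MvPolynomial σ ℂ)).mulVec ((M.map C).mulVec v) = v := by
  rw [Matrix.mulVec_mulVec, ← Matrix.map_mul, Matrix.nonsing_inv_mul _ (isUnit_iff_ne_zero.2 hM),
    Matrix.map_one _ (map_zero _) (map_one _), Matrix.one_mulVec]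

/-- An invertible constant matrix maps vectors without common factor to such vectors. -/
theorem MvPolynomial.isUnit_of_forall_dvd_mulVec {σ ι : Type*} [Fintype ι] [DecidableEq ι]
    (M : Matrix ι ι ℂ) (hM : M.det ≠ 0) {v : ι → MvPolynomial σ ℂ}
    (hv : ∀ r, (∀ i, r ∣ v i) → IsUnit r) (r : MvPolynomial σ ℂ)
    (hr : ∀ i, r ∣ (M.map C).mulVec v i) : IsUnit r := by
  refine hv r fun i => ?_
  rw [← inv_map_mulVec_map_mulVec M hM v]
  exact Finset.dvd_sum fun j _ => (hr j).mul_left _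

/-- An invertible constant matrix does not lower the degree of a vector of polynomials. -/
theorem MvPolynomial.totalDegree_le_of_mulVec {σ ι : Type*} [Fintype ι] [DecidableEq ι]
    (M : Matrix ι ι ℂ) (hM : M.det ≠ 0) {v : ι → MvPolynomial σ ℂ} {m : ℕ}
    (h : ∀ i, ((M.map C).mulVec v i).totalDegree ≤ m) (i : ι) : (v i).totalDegree ≤ m := by
  rw [← inv_map_mulVec_map_mulVec M hM v]
  refine totalDegree_finsetSum_le fun j _ => (totalDegree_mul _ _).trans ?_
  simpa using h j

/-! ### Affine forms -/

/-- An affine form without zeros on the unit sphere of `ℂ²` has none in the closed ball. -/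
theorem normSq_lt_of_affine_ne_zero {a b d : ℂ}
    (h : ∀ Z ∈ unitSphere 2, a * Z 0 + b * Z 1 + d ≠ 0) :
    ‖a‖ ^ 2 + ‖b‖ ^ 2 < ‖d‖ ^ 2 := by
  by_contra! hle
  set s : ℝ := ‖a‖ ^ 2 + ‖b‖ ^ 2 with hs
  rcases (show 0 ≤ s by positivity).eq_or_lt with h0 | hpos
  · have hd : d = 0 := by
      have : ‖d‖ ^ 2 = 0 := le_antisymm (by linarith) (by positivity)
      simpa using this
    have ha : a = 0 := by
      have : ‖a‖ ^ 2 = 0 := le_antisymm (by nlinarith [sq_nonneg ‖b‖]) (by positivity)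
      simpa using this
    have hb : b = 0 := by
      have : ‖b‖ ^ 2 = 0 := le_antisymm (by nlinarith [sq_nonneg ‖a‖]) (by positivity)
      simpa using this
    refine h (EuclideanSpace.single 0 1) (by simp [unitSphere]) ?_
    simp [ha, hb, hd]
  · set t : ℝ := Real.sqrt (s - ‖d‖ ^ 2) / s with ht
    have ht2 : t ^ 2 * s ^ 2 = s - ‖d‖ ^ 2 := by
      rw [ht, div_pow, Real.sq_sqrt (by linarith)]
      field_simp
    have hsC : (s : ℂ) ≠ 0 := by exact_mod_cast hpos.ne'
    have hconj : a * starRingEnd ℂ a + b * starRingEnd ℂ b = s := by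
      rw [Complex.mul_conj', Complex.mul_conj', hs]; push_cast; ring
    have hdd : d * starRingEnd ℂ d = (‖d‖ ^ 2 : ℝ) := by
      rw [Complex.mul_conj']; push_cast; ring
    have htC : (t : ℂ) ^ 2 * s ^ 2 = s - (‖d‖ ^ 2 : ℝ) := by exact_mod_cast ht2
    -- The first summand is the point of the line `a z + b w + d = 0` nearest to the origin; adding
    -- `t (-b, a)`, which is orthogonal to it and parallel to the line, reaches norm one for this
    -- `t`.
    refine h (WithLp.toLp 2 ![-d * starRingEnd ℂ a / s - t * b, -d * starRingEnd ℂ b / s + t * a])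
      ?_ ?_
    · have : ((‖-d * starRingEnd ℂ a / s - t * b‖ ^ 2 + ‖-d * starRingEnd ℂ b / s + t * a‖ ^ 2 : ℝ)
          : ℂ) = 1 := by
        push_cast
        rw [← Complex.mul_conj', ← Complex.mul_conj']
        simp only [map_sub, map_add, map_mul, map_div₀, map_neg, Complex.conj_conj,
          Complex.conj_ofReal]
        field_simp
        linear_combination (d * starRingEnd ℂ d + t ^ 2 * s ^ 2) * hconj + (s : ℂ) * htC
          + (s : ℂ) * hdd
      have h1 : ‖-d * starRingEnd ℂ a / s - t * b‖ ^ 2 +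
          ‖-d * starRingEnd ℂ b / s + t * a‖ ^ 2 = 1 := by
        exact_mod_cast this
      simp only [unitSphere, mem_sphere_iff_norm, sub_zero, EuclideanSpace.norm_eq,
        Fin.sum_univ_two, Matrix.cons_val_zero, Matrix.cons_val_one, h1, Real.sqrt_one]
    · simp only [Matrix.cons_val_zero, Matrix.cons_val_one]
      field_simp
      linear_combination -d * hconj

theorem MvPolynomial.totalDegree_affine_le {σ : Type*} [Fintype σ] (c : σ → ℂ) (d : ℂ) :
    (∑ i, C (c i) * X i + C d : MvPolynomial σ ℂ).totalDegree ≤ 1 := by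
  refine (totalDegree_add _ _).trans (max_le (totalDegree_finsetSum_le fun i _ => ?_) (by simp))
  exact (totalDegree_mul _ _).trans (by simp)

open MvPolynomial in
/-- A nonconstant affine form is irreducible and its powers have the expected degree. -/
theorem MvPolynomial.affine_pow_totalDegree_and_irreducible {a b : ℂ}
    (h : ¬(a = 0 ∧ b = 0)) (d : ℂ) (m : ℕ) :
    ((C a * X 0 + C b * X 1 + C d : MvPolynomial (Fin 2) ℂ) ^ m).totalDegree = m ∧
    Irreducible (C a * X 0 + C b * X 1 + C d : MvPolynomial (Fin 2) ℂ) := by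
  set l : MvPolynomial (Fin 2) ℂ := C a * X 0 + C b * X 1 + C d with hl
  have hle : l.totalDegree ≤ 1 := by
    simpa [hl, Fin.sum_univ_two] using totalDegree_affine_le ![a, b] d
  have heval : ∀ x : Fin 2 → ℂ, eval x l = a * x 0 + b * x 1 + d := fun x => by simp [hl]
  have hdeg : l.totalDegree = 1 := by
    refine hle.antisymm (Nat.one_le_iff_ne_zero.2 fun h0 => h ?_)
    have hc := totalDegree_eq_zero_iff_eq_C.1 h0
    have hconst : ∀ x : Fin 2 → ℂ, eval x l = coeff 0 l := fun x => by
      conv_lhs => rw [hc]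
      simp
    have h00 := (heval ![0, 0]).symm.trans (hconst _)
    have h10 := (heval ![1, 0]).symm.trans (hconst _)
    have h01 := (heval ![0, 1]).symm.trans (hconst _)
    simp only [Matrix.cons_val_zero, Matrix.cons_val_one] at h00 h10 h01
    exact ⟨by linear_combination h10 - h00, by linear_combination h01 - h00⟩
  have hl0 : l ≠ 0 := by
    intro h0
    simp [h0] at hdeg
  refine ⟨?_, irreducible_of_totalDegree_eq_one hdeg fun x hx => isUnit_iff_ne_zero.2 ?_⟩
  · induction m with
    | zero => simp
    | succ m ih =>
      rw [pow_succ, totalDegree_mul_of_isDomain (pow_ne_zero _ hl0) hl0, ih, hdeg]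
  · rintro rfl
    refine hl0 (MvPolynomial.ext _ _ fun i => ?_)
    simpa using hx i

/-! ### The obstruction to equivalence with a polynomial map -/

open MvPolynomial in
/-- If a rational sphere map `p / q` in lowest terms is equivalent to a polynomial map, then some
linear combination of the numerators and the denominator is a power of an affine form which has no
zeros in the closed unit ball. Unless the form is constant, the exponent is at least the degree of
the denominator. -/
theorem exists_combination_eq_affine_pow {N : ℕ} {F P : CSpace 2 → CSpace N}
    {p : Fin N → MvPolynomial (Fin 2) ℂ} {q : MvPolynomial (Fin 2) ℂ}
    (hcop : ∀ r : MvPolynomial (Fin 2) ℂ, (∀ j, r ∣ p j) → r ∣ q → IsUnit r)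
    (hF : ∀ Z ∈ unitSphere 2, eval (fun i => Z i) q ≠ 0 ∧
      ∀ j, F Z j = eval (fun i => Z i) (p j) / eval (fun i => Z i) q)
    (hmaps : Set.MapsTo F (unitSphere 2) (unitSphere N))
    (hP : IsPolynomialMap P) (hFP : SphereEquivalent F P) :
    ∃ (c : Fin N → ℂ) (d a b k : ℂ) (m : ℕ), k ≠ 0 ∧ ‖a‖ ^ 2 + ‖b‖ ^ 2 < 1 ∧
      (a = 0 ∧ b = 0 → m = 0) ∧
      (¬(a = 0 ∧ b = 0) → q.totalDegree ≤ m) ∧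
      ∑ j, C (c j) * p j + C d * q = C k * (C a * X 0 + C b * X 1 + C 1) ^ m := by
  obtain ⟨P', hP'⟩ := hP
  obtain ⟨ψ, φ, ⟨-, A, u, v, e, -, hψ⟩, ⟨-, A', u', v', e', hdet, hφ⟩, heq⟩ := hFP
  have hlt := normSq_lt_of_affine_ne_zero (a := v 0) (b := v 1) (d := e) fun Z hZ => by
    simpa [Fin.sum_univ_two] using (hψ Z hZ).1
  have he : e ≠ 0 := by
    rintro rfl
    simp only [norm_zero, ne_eq, OfNat.ofNat_ne_zero, not_false_eq_true, zero_pow] at hlt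
    nlinarith [sq_nonneg ‖v 0‖, sq_nonneg ‖v 1‖]
  set a : ℂ := v 0 / e with ha
  set b : ℂ := v 1 / e with hb
  set l : MvPolynomial (Fin 2) ℂ := C a * X 0 + C b * X 1 + C 1 with hl
  have hab : ‖a‖ ^ 2 + ‖b‖ ^ 2 < 1 := by
    have he' : 0 < ‖e‖ ^ 2 := by positivity
    rw [ha, hb, norm_div, norm_div, div_pow, div_pow, ← add_div, div_lt_one he']
    exact hlt
  have hle : ∀ Z : CSpace 2, (∑ k, v k * Z k) + e = e * eval (fun i => Z i) l := by
    intro Z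
    simp only [hl, ha, hb, Fin.sum_univ_two, map_add, map_mul, eval_C, eval_X, map_one]
    field_simp
  set L : Fin 2 → MvPolynomial (Fin 2) ℂ := fun j =>
    C e⁻¹ * (∑ k, C (A j k) * X k + C (u j)) with hL
  have hψ' : ∀ Z ∈ unitSphere 2, eval (fun i => Z i) l ≠ 0 ∧
      ∀ j, ψ Z j = eval (fun i => Z i) (L j) / eval (fun i => Z i) l := by
    intro Z hZ
    obtain ⟨h0, h1⟩ := hψ Z hZ
    rw [hle] at h0 h1
    have h2 := right_ne_zero_of_mul h0
    refine ⟨h2, fun j => ?_⟩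
    rw [h1]
    simp only [hL, map_add, map_mul, eval_C, eval_X, map_sum]
    field_simp
  have hldeg : l.totalDegree ≤ 1 := by
    simpa [hl, Fin.sum_univ_two] using totalDegree_affine_le ![a, b] 1
  choose D G hGdeg hG using fun j => exists_eval_div_mul_pow (P' j)
    (fun i => (totalDegree_mul _ _).trans (by
      simpa using totalDegree_affine_le (A i) (u i)) : ∀ i, (L i).totalDegree ≤ 1) hldeg
  set lam : MvPolynomial (Fin 2) ℂ := ∑ j, C (v' j) * p j + C e' * q with hlam
  set num : Fin N → MvPolynomial (Fin 2) ℂ := fun j => ∑ k, C (A' j k) * p k + C (u' j) * q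
    with hnum
  -- On the sphere both `G j / l ^ D j` and `num j / lam` are the `j`-th component of `P ∘ ψ`.
  have hid : ∀ j, G j * lam = num j * l ^ D j := by
    intro j
    refine eq_of_eval_eq_on_unitSphere fun Z hZ => ?_
    obtain ⟨hq, hFZ⟩ := hF Z hZ
    obtain ⟨hlZ, hψZ⟩ := hψ' Z hZ
    obtain ⟨h0, h1⟩ := hφ (F Z) (hmaps hZ)
    have hlamZ : (∑ k, v' k * F Z k) + e' =
        eval (fun i => Z i) lam / eval (fun i => Z i) q := by
      simp only [hlam, hFZ, map_add, map_mul, eval_C, map_sum, add_div, Finset.sum_div]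
      field_simp
    have hnumZ : (∑ k, A' j k * F Z k) + u' j =
        eval (fun i => Z i) (num j) / eval (fun i => Z i) q := by
      simp only [hnum, hFZ, map_add, map_mul, eval_C, map_sum, add_div, Finset.sum_div]
      field_simp
    have hlam0 : eval (fun i => Z i) lam ≠ 0 := fun h => h0 (by rw [hlamZ, h, zero_div])
    have h2 : eval (fun i => eval (fun i => Z i) (L i) / eval (fun i => Z i) l) (P' j) =
        eval (fun i => Z i) (num j) / eval (fun i => Z i) lam := by
      have h3 := congrArg (fun Y : CSpace N => Y j) (heq Z hZ)
      simp only [hP', h1, hlamZ, hnumZ, hψZ] at h3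
      rw [h3]
      field_simp
    rw [map_mul, map_mul, map_pow, hG j _ hlZ, h2]
    field_simp
  -- The sum of the `D j` serves as a common exponent. The entry `lam` is added to the family
  -- because only `num` and `lam` together are known to have no common factor.
  have hdvd : lam ∣ l ^ ∑ j, D j := by
    refine dvd_of_forall_dvd_mul (v := Sum.elim num fun _ : Fin 1 => lam) ?_ ?_
    · intro r hr
      refine isUnit_of_forall_dvd_mulVec _ hdet (v := Sum.elim p fun _ : Fin 1 => q)
        (fun s hs => hcop s (fun j => hs (Sum.inl j)) (hs (Sum.inr 0))) r ?_
      rintro (j | j)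
      · simpa [Matrix.mulVec, dotProduct, hnum] using hr (Sum.inl j)
      · simpa [Matrix.mulVec, dotProduct, hlam] using hr (Sum.inr j)
    · rintro (j | j)
      · have h1 : lam ∣ num j * l ^ D j := ⟨G j, by rw [← hid, mul_comm]⟩
        obtain ⟨x, hx⟩ := pow_dvd_pow l (Finset.single_le_sum (f := D)
          (fun _ _ => Nat.zero_le _) (Finset.mem_univ j))
        simp only [Sum.elim_inl]
        rw [hx, ← mul_assoc]
        exact h1.mul_right x
      · exact dvd_mul_right _ _
  have hfin : ∃ m : ℕ, (a = 0 ∧ b = 0 → m = 0) ∧ Associated lam (l ^ m) := by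
    by_cases h0 : a = 0 ∧ b = 0
    · refine ⟨0, fun _ => rfl, ?_⟩
      have : l = 1 := by simp [hl, h0.1, h0.2]
      rw [this, one_pow] at hdvd
      simpa using associated_one_iff_isUnit.2 (isUnit_of_dvd_one hdvd)
    · obtain ⟨m, -, hm⟩ := (dvd_prime_pow
        (affine_pow_totalDegree_and_irreducible h0 1 1).2.prime _).1 hdvd
      exact ⟨m, fun h => absurd h h0, hm⟩
  obtain ⟨m, hm, hassoc⟩ := hfin
  obtain ⟨w, hw⟩ := hassoc.symm
  obtain ⟨k, hk, hkw⟩ := isUnit_iff_eq_C_of_isReduced.1 w.isUnit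
  have hlam' : lam = C k * l ^ m := by rw [← hw, hkw, mul_comm]
  refine ⟨v', e', a, b, k, m, hk.ne_zero, hab, hm, fun h0 => ?_, hlam'⟩
  have hpow := fun m => (affine_pow_totalDegree_and_irreducible h0 1 m).1
  have hl0 : l ≠ 0 := (affine_pow_totalDegree_and_irreducible h0 1 1).2.ne_zero
  refine totalDegree_le_of_mulVec _ hdet (v := Sum.elim p fun _ : Fin 1 => q) ?_ (Sum.inr 0)
  -- In `hid` the degrees give `deg G j + m = deg num j + D j`, and `deg G j ≤ D j`. The bound then
  -- passes from `(num, lam)` to `q` through the inverse matrix.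
  have hnumdeg : ∀ j, (num j).totalDegree ≤ m := by
    intro j
    by_cases hj : num j = 0
    · simp [hj]
    have hG0 : G j ≠ 0 := by
      intro h
      have := hid j
      rw [h, zero_mul] at this
      exact mul_ne_zero hj (pow_ne_zero _ hl0) this.symm
    have h1 := congrArg totalDegree (hid j)
    have hk0 : (C k : MvPolynomial (Fin 2) ℂ) ≠ 0 := by simpa using hk.ne_zero
    rw [hlam', totalDegree_mul_of_isDomain hG0 (mul_ne_zero hk0 (pow_ne_zero _ hl0)),
      totalDegree_mul_of_isDomain hk0 (pow_ne_zero _ hl0), totalDegree_C, hpow,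
      totalDegree_mul_of_isDomain hj (pow_ne_zero _ hl0), hpow] at h1
    have := hGdeg j
    omega
  rintro (j | j)
  · simpa [Matrix.mulVec, dotProduct, hnum] using hnumdeg j
  · have h1 : lam.totalDegree ≤ m := by
      rw [hlam']
      exact (totalDegree_mul _ _).trans (by rw [totalDegree_C, zero_add, hpow])
    simpa [Matrix.mulVec, dotProduct, hlam] using h1

/-! ### Cubics and their coefficients -/

open MvPolynomial in
/-- The polynomial of degree at most three in two variables with given coefficients, ordered as
`1, z, w, z², zw, w², z³, z²w, zw², w³`. -/
noncomputable def cubic (c : Fin 10 → ℂ) : MvPolynomial (Fin 2) ℂ :=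
  C (c 0) + C (c 1) * X 0 + C (c 2) * X 1 + C (c 3) * X 0 ^ 2 + C (c 4) * (X 0 * X 1) +
    C (c 5) * X 1 ^ 2 + C (c 6) * X 0 ^ 3 + C (c 7) * (X 0 ^ 2 * X 1) +
    C (c 8) * (X 0 * X 1 ^ 2) + C (c 9) * X 1 ^ 3

-- General algebras are needed because common zeros are later taken in quotients of the polynomial
-- ring.
open MvPolynomial in
theorem aeval_cubic {R : Type*} [CommRing R] [Algebra ℂ R] (x : Fin 2 → R) (c : Fin 10 → ℂ) :
    aeval x (cubic c) = algebraMap ℂ R (c 0) + algebraMap ℂ R (c 1) * x 0 +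
      algebraMap ℂ R (c 2) * x 1 + algebraMap ℂ R (c 3) * x 0 ^ 2 +
      algebraMap ℂ R (c 4) * (x 0 * x 1) + algebraMap ℂ R (c 5) * x 1 ^ 2 +
      algebraMap ℂ R (c 6) * x 0 ^ 3 + algebraMap ℂ R (c 7) * (x 0 ^ 2 * x 1) +
      algebraMap ℂ R (c 8) * (x 0 * x 1 ^ 2) + algebraMap ℂ R (c 9) * x 1 ^ 3 := by
  simp [cubic]

open MvPolynomial in
theorem eval_cubic (x : Fin 2 → ℂ) (c : Fin 10 → ℂ) :
    eval x (cubic c) = c 0 + c 1 * x 0 + c 2 * x 1 + c 3 * x 0 ^ 2 + c 4 * (x 0 * x 1) +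
      c 5 * x 1 ^ 2 + c 6 * x 0 ^ 3 + c 7 * (x 0 ^ 2 * x 1) + c 8 * (x 0 * x 1 ^ 2) +
      c 9 * x 1 ^ 3 := by
  simp [cubic]

open MvPolynomial in
theorem totalDegree_cubic_le (c : Fin 10 → ℂ) : (cubic c).totalDegree ≤ 3 := by
  have hX : ∀ (i : Fin 2) (n : ℕ), (X i ^ n : MvPolynomial (Fin 2) ℂ).totalDegree ≤ n :=
    fun i n => (totalDegree_X_pow i n).le
  have hC : ∀ (a : ℂ) (p : MvPolynomial (Fin 2) ℂ), p.totalDegree ≤ 3 →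
      (C a * p).totalDegree ≤ 3 := fun a p h => (totalDegree_mul _ _).trans (by simpa using h)
  have hXX : ∀ m n : ℕ, m + n ≤ 3 →
      (X 0 ^ m * X 1 ^ n : MvPolynomial (Fin 2) ℂ).totalDegree ≤ 3 := fun m n h =>
    (totalDegree_mul _ _).trans ((add_le_add (hX 0 m) (hX 1 n)).trans h)
  have hadd : ∀ p q : MvPolynomial (Fin 2) ℂ, p.totalDegree ≤ 3 → q.totalDegree ≤ 3 →
      (p + q).totalDegree ≤ 3 := fun p q hp hq => (totalDegree_add _ _).trans (max_le hp hq)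
  unfold cubic
  refine hadd _ _ (hadd _ _ (hadd _ _ (hadd _ _ (hadd _ _ (hadd _ _ (hadd _ _ (hadd _ _ (hadd _ _
    ?_ ?_) ?_) ?_) ?_) ?_) ?_) ?_) ?_) ?_
  · simp
  · exact hC _ _ (by simp)
  · exact hC _ _ (by simp)
  · exact hC _ _ ((hX _ _).trans (by norm_num))
  · exact hC _ _ (by simpa using hXX 1 1 (by norm_num))
  · exact hC _ _ ((hX _ _).trans (by norm_num))
  · exact hC _ _ (hX _ _)
  · exact hC _ _ (by simpa using hXX 2 1 (by norm_num))
  · exact hC _ _ (by simpa using hXX 1 2 (by norm_num))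
  · exact hC _ _ (hX _ _)

/-- The coefficients of a polynomial function of degree at most three are determined by it. -/
theorem cubic_injective : Function.Injective cubic := by
  intro c d h
  have key : ∀ z w : ℂ, _ := fun z w => congrArg (MvPolynomial.eval ![z, w]) h
  simp only [eval_cubic, Matrix.cons_val_zero, Matrix.cons_val_one] at key
  -- Four points on each axis determine the pure powers; the three points `(1, 1)`, `(1, -1)`, `(-1,
  -- 1)` separate the three mixed terms by parity.
  have e1 := key 0 0
  have e2 := key 1 0
  have e3 := key (-1) 0
  have e4 := key 2 0
  have e5 := key 0 1
  have e6 := key 0 (-1)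
  have e7 := key 0 2
  have e8 := key 1 1
  have e9 := key 1 (-1)
  have e10 := key (-1) 1
  have h0 : c 0 = d 0 := by linear_combination e1
  have h3 : c 3 = d 3 := by linear_combination (e2 + e3) / 2 - e1
  have h6 : c 6 = d 6 := by
    linear_combination (e4 - e1 - 4 * ((e2 + e3) / 2 - e1)) / 6 - (e2 - e3) / 6
  have h1 : c 1 = d 1 := by linear_combination (e2 - e3) / 2 - h6
  have h5 : c 5 = d 5 := by linear_combination (e5 + e6) / 2 - e1
  have h9 : c 9 = d 9 := by
    linear_combination (e7 - e1 - 4 * ((e5 + e6) / 2 - e1)) / 6 - (e5 - e6) / 6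
  have h2 : c 2 = d 2 := by linear_combination (e5 - e6) / 2 - h9
  have h8 : c 8 = d 8 := by
    linear_combination (e8 + e9) / 2 - h0 - h1 - h3 - h5 - h6
  have h7 : c 7 = d 7 := by
    linear_combination (e8 + e10) / 2 - h0 - h2 - h3 - h5 - h9
  have h4 : c 4 = d 4 := by
    linear_combination e8 - h0 - h1 - h2 - h3 - h5 - h6 - h7 - h8 - h9
  funext i
  fin_cases i <;> assumption

-- The indices from 6 on are those of the cubic monomials, whose coefficients would all vanish in
-- lower degree.
open MvPolynomial in
theorem totalDegree_cubic {c : Fin 10 → ℂ} (h : ∃ i : Fin 10, 6 ≤ i ∧ c i ≠ 0) :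
    (cubic c).totalDegree = 3 := by
  refine (totalDegree_cubic_le c).antisymm ?_
  by_contra! hlt
  have hco : ∀ i j : ℕ, i + j = 3 →
      coeff (Finsupp.single 0 i + Finsupp.single 1 j) (cubic c) = 0 := fun i j hij =>
    coeff_eq_zero_of_totalDegree_lt (by
      rwa [← Finsupp.degree_apply, map_add, Finsupp.degree_single, Finsupp.degree_single, hij])
  have hX : ∀ i j : ℕ, (X 0 ^ i * X 1 ^ j : MvPolynomial (Fin 2) ℂ) =
      monomial (Finsupp.single 0 i + Finsupp.single 1 j) 1 := fun i j => by
    simp [X_pow_eq_monomial, monomial_mul]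
  have hcub : cubic c = C (c 0) * (X 0 ^ 0 * X 1 ^ 0) + C (c 1) * (X 0 ^ 1 * X 1 ^ 0) +
      C (c 2) * (X 0 ^ 0 * X 1 ^ 1) + C (c 3) * (X 0 ^ 2 * X 1 ^ 0) +
      C (c 4) * (X 0 ^ 1 * X 1 ^ 1) + C (c 5) * (X 0 ^ 0 * X 1 ^ 2) +
      C (c 6) * (X 0 ^ 3 * X 1 ^ 0) + C (c 7) * (X 0 ^ 2 * X 1 ^ 1) +
      C (c 8) * (X 0 ^ 1 * X 1 ^ 2) + C (c 9) * (X 0 ^ 0 * X 1 ^ 3) := by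
    simp [cubic]
  have hinj : ∀ i j k l : ℕ, (Finsupp.single (0 : Fin 2) i + Finsupp.single 1 j =
      Finsupp.single 0 k + Finsupp.single 1 l) ↔ i = k ∧ j = l := fun i j k l => by
    simp [Finsupp.ext_iff, Fin.forall_fin_two]
  simp only [hcub, hX, coeff_add, coeff_C_mul, coeff_monomial, hinj] at hco
  obtain ⟨i, hi, hc⟩ := h
  have h6 := hco 3 0 rfl
  have h7 := hco 2 1 rfl
  have h8 := hco 1 2 rfl
  have h9 := hco 0 3 rfl
  norm_num at h6 h7 h8 h9
  fin_cases i <;> simp_all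

/-! ### Common factors and common zeros -/

open MvPolynomial in
/-- If the common zeros of a family of polynomials in two variables, with values in any integral
domain, are confined to one constant point, then the family has no common factor. -/
theorem isUnit_of_forall_dvd_of_zeros {ι : Type*} {v : ι → MvPolynomial (Fin 2) ℂ} {z₀ w₀ : ℂ}
    (hv : ∀ (R : Type) [CommRing R] [IsDomain R] [Algebra ℂ R] (x : Fin 2 → R),
      (∀ i, aeval x (v i) = 0) → x 0 = algebraMap ℂ R z₀ ∧ x 1 = algebraMap ℂ R w₀)
    (hne : ∃ i, v i ≠ 0) {r : MvPolynomial (Fin 2) ℂ} (hr : ∀ i, r ∣ v i) : IsUnit r := by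
  by_contra hu
  have hr0 : r ≠ 0 := by
    rintro rfl
    exact hne.elim fun i hi => hi (zero_dvd_iff.1 (hr i))
  obtain ⟨π, hπ, hπr⟩ := WfDvdMonoid.exists_irreducible_factor hu hr0
  have hprime : (Ideal.span {π}).IsPrime :=
    (Ideal.span_singleton_prime hπ.ne_zero).2 hπ.prime
  let φ : MvPolynomial (Fin 2) ℂ →ₐ[ℂ] MvPolynomial (Fin 2) ℂ ⧸ Ideal.span {π} :=
    Ideal.Quotient.mkₐ ℂ (Ideal.span {π})
  have hφ : ∀ p, φ p = 0 ↔ π ∣ p := fun p => by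
    change Ideal.Quotient.mk _ p = 0 ↔ _
    rw [Ideal.Quotient.eq_zero_iff_mem, Ideal.mem_span_singleton]
  -- Modulo an irreducible common factor `π` the classes of the variables are a common zero in a
  -- domain, so `π` divides both `X 0 - z₀` and `X 1 - w₀`. The first is irreducible, hence would
  -- divide the second.
  obtain ⟨h0, h1⟩ := hv _ (fun i => φ (X i)) fun i => by
    have : aeval (fun i => φ (X i)) = φ := by
      ext i
      simp
    rw [this, hφ]
    exact hπr.trans (hr i)
  have h0' : π ∣ C 1 * X 0 + C 0 * X 1 + C (-z₀) := by
    rw [← hφ]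
    simp only [map_one, one_mul, map_zero, zero_mul, add_zero, map_neg, map_add, h0]
    rw [← MvPolynomial.algebraMap_eq, φ.commutes, add_neg_cancel]
  have h1' : π ∣ X 1 - C w₀ := by
    rw [← hφ, map_sub, ← MvPolynomial.algebraMap_eq, φ.commutes, h1, sub_self]
  have hirr := (affine_pow_totalDegree_and_irreducible (a := 1) (b := 0) (by simp) (-z₀) 1).2
  obtain ⟨s, hs⟩ := (hπ.dvd_symm hirr h0').trans h1'
  have := congrArg (eval ![z₀, w₀ + 1]) hs
  simp at this

/-! ### The criterion in terms of coefficients -/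

/-- A sum over `Fin N` whose terms vanish except for the first `n` and the last. -/
theorem Fin.sum_eq_sum_castLE_add_last {M : Type*} [AddCommMonoid M] {n N : ℕ} (hn : n < N)
    (H : Fin N → M) (h0 : ∀ j : Fin N, (j : ℕ) + 1 ≠ N → n ≤ j → H j = 0) :
    ∑ j, H j = ∑ i : Fin n, H (Fin.castLE hn.le i) + H ⟨N - 1, by omega⟩ := by
  obtain ⟨t, rfl⟩ : ∃ t, N = n + t + 1 := ⟨N - n - 1, by omega⟩
  rw [Fin.sum_univ_castSucc, Fin.sum_univ_add]
  rw [Finset.sum_eq_zero (s := Finset.univ) (f := fun i : Fin t => H (Fin.natAdd n i).castSucc)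
    fun i _ => h0 _ (by simp; omega) (by simp), add_zero]
  rfl

/-- The entries of `paddedQuotient`, by position. -/
theorem paddedQuotient_ofFn_apply {n N : ℕ} (f : Fin n → ℂ) (g δ : ℂ) (j : Fin N) :
    paddedQuotient N (List.ofFn f) g δ j =
      (if (j : ℕ) + 1 = N then g else if h : (j : ℕ) < n then f ⟨j, h⟩ else 0) / δ := by
  simp only [paddedQuotient, List.getD_eq_getElem?_getD, List.getElem?_ofFn]
  split_ifs <;> simp

open MvPolynomial in
/-- A criterion for a rational map of degree three, given by the coefficients of its components, to
be a sphere map which is not equivalent to a polynomial map. -/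
theorem sphereMap_not_equivalent_polynomial {n N : ℕ} (hn : n < N) {F : CSpace 2 → CSpace N}
    (s : Fin n → ℂ) (hs : ∀ i, s i ≠ 0) (t : ℂ) (ht : t ≠ 0)
    (f : Fin n → Fin 10 → ℂ) (g δ : Fin 10 → ℂ)
    (hF : ∀ Z, F Z = paddedQuotient N
      (List.ofFn fun i => s i * eval (fun i => Z i) (cubic (f i)))
      (t * eval (fun i => Z i) (cubic g)) (t * eval (fun i => Z i) (cubic δ)))
    (hid : ∀ x : Fin 2 → ℂ, ‖x 0‖ ^ 2 + ‖x 1‖ ^ 2 = 1 →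
      ∑ i, ‖s i‖ ^ 2 * ‖eval x (cubic (f i))‖ ^ 2 + ‖t‖ ^ 2 * ‖eval x (cubic g)‖ ^ 2 =
        ‖t‖ ^ 2 * ‖eval x (cubic δ)‖ ^ 2)
    (z₀ w₀ : ℂ) (hz₀ : ‖z₀‖ ^ 2 + ‖w₀‖ ^ 2 ≠ 1)
    (hzero : ∀ (R : Type) [CommRing R] [IsDomain R] [Algebra ℂ R] (x : Fin 2 → R),
      (∀ i, aeval x (cubic (f i)) = 0) → aeval x (cubic g) = 0 → aeval x (cubic δ) = 0 →
      x 0 = algebraMap ℂ R z₀ ∧ x 1 = algebraMap ℂ R w₀)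
    (hdeg : ∃ i : Fin 10, 6 ≤ i ∧ δ i ≠ 0)
    (hpow : ∀ (c : Fin n → ℂ) (d e a b : ℂ), ‖a‖ ^ 2 + ‖b‖ ^ 2 < 1 →
      (fun j => ∑ i, c i * f i j + d * g j + e * δ j) ≠ ![1, 0, 0, 0, 0, 0, 0, 0, 0, 0] ∧
      (fun j => ∑ i, c i * f i j + d * g j + e * δ j) ≠
        ![1, 3 * a, 3 * b, 3 * a ^ 2, 6 * a * b, 3 * b ^ 2, a ^ 3, 3 * a ^ 2 * b,
          3 * a * b ^ 2, b ^ 3]) :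
    Set.MapsTo F (unitSphere 2) (unitSphere N) ∧
    IsRationalOfDegree F 3 ∧
    ¬ ∃ P : CSpace 2 → CSpace N, IsPolynomialMap P ∧
        Set.MapsTo P (unitSphere 2) (unitSphere N) ∧ SphereEquivalent F P := by
  set p : Fin N → MvPolynomial (Fin 2) ℂ := fun j =>
    if (j : ℕ) + 1 = N then C t * cubic g
    else if h : (j : ℕ) < n then C (s ⟨j, h⟩) * cubic (f ⟨j, h⟩) else 0 with hp
  set q : MvPolynomial (Fin 2) ℂ := C t * cubic δ with hq
  have hp0 : ∀ j : Fin N, (j : ℕ) + 1 ≠ N → n ≤ j → p j = 0 := fun j h1 h2 => by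
    simp [hp, h1, h2]
  have hpi : ∀ i : Fin n, p (Fin.castLE hn.le i) = C (s i) * cubic (f i) := fun i => by
    have h : (i : ℕ) + 1 ≠ N := by have := i.2; omega
    simp [hp, h]
  have hpl : p ⟨N - 1, by omega⟩ = C t * cubic g := by
    simp only [hp]
    rw [if_pos (by omega)]
  have hsphere : ∀ Z ∈ unitSphere 2, ‖Z 0‖ ^ 2 + ‖Z 1‖ ^ 2 = 1 := fun Z hZ => by
    have h1 : ‖Z‖ = 1 := by simpa [unitSphere] using hZ
    have h2 := EuclideanSpace.norm_sq_eq Z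
    rw [h1, Fin.sum_univ_two] at h2
    linarith
  have hsum : ∀ Z ∈ unitSphere 2, ∑ j, ‖eval (fun i => Z i) (p j)‖ ^ 2 =
      ‖eval (fun i => Z i) q‖ ^ 2 := fun Z hZ => by
    rw [Fin.sum_eq_sum_castLE_add_last hn _ fun j h1 h2 => by simp [hp0 j h1 h2]]
    simpa [hpi, hpl, hq, mul_pow] using hid (fun i => Z i) (hsphere Z hZ)
  -- At a pole on the sphere the identity of squared norms makes all numerators vanish too, so the
  -- pole would be `(z₀, w₀)`, which lies off the sphere.
  have hq0 : ∀ Z ∈ unitSphere 2, eval (fun i => Z i) q ≠ 0 := fun Z hZ h0 => by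
    have h1 := hsum Z hZ
    rw [h0, norm_zero, zero_pow two_ne_zero,
      Finset.sum_eq_zero_iff_of_nonneg fun _ _ => by positivity] at h1
    have h2 : ∀ j, eval (fun i => Z i) (p j) = 0 := fun j => by simpa using h1 j (Finset.mem_univ j)
    obtain ⟨e0, e1⟩ := hzero ℂ (fun i => Z i)
      (fun i => by simpa [hpi, hs, coe_aeval_eq_eval] using h2 (Fin.castLE hn.le i))
      (by simpa [hpl, ht, coe_aeval_eq_eval] using h2 ⟨N - 1, by omega⟩)
      (by simpa [hq, ht, coe_aeval_eq_eval] using h0)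
    refine hz₀ ?_
    simp only [Algebra.algebraMap_self, RingHom.id_apply] at e0 e1
    rw [← e0, ← e1]
    exact hsphere Z hZ
  have hFq : ∀ Z ∈ unitSphere 2, eval (fun i => Z i) q ≠ 0 ∧
      ∀ j, F Z j = eval (fun i => Z i) (p j) / eval (fun i => Z i) q := fun Z hZ => by
    refine ⟨hq0 Z hZ, fun j => ?_⟩
    rw [hF, paddedQuotient_ofFn_apply]
    simp only [hp, hq]
    split_ifs <;> simp
  have hmaps : Set.MapsTo F (unitSphere 2) (unitSphere N) := fun Z hZ => by
    have h1 : ‖F Z‖ ^ 2 = 1 := by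
      rw [EuclideanSpace.norm_sq_eq]
      simp only [(hFq Z hZ).2, norm_div, div_pow]
      rw [← Finset.sum_div, hsum Z hZ, div_self (by simpa using hq0 Z hZ)]
    have h2 : ‖F Z‖ = 1 := (pow_eq_one_iff_of_nonneg (norm_nonneg _) two_ne_zero).1 h1
    simpa [unitSphere] using h2
  have hdC : ∀ (a : ℂ) (x : Fin 10 → ℂ), (C a * cubic x).totalDegree ≤ 3 := fun a x =>
    (totalDegree_mul _ _).trans (by simpa using totalDegree_cubic_le x)
  have hqdeg : q.totalDegree = 3 := by
    have h0 : cubic δ ≠ 0 := fun h => by simpa [h] using totalDegree_cubic hdeg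
    rw [hq, totalDegree_mul_of_isDomain (by simpa using ht) h0, totalDegree_cubic hdeg]
    simp
  have hunit : ∀ a : ℂ, a ≠ 0 → IsUnit (C a : MvPolynomial (Fin 2) ℂ) := fun a ha =>
    (isUnit_iff_ne_zero.2 ha).map C
  have hcop : ∀ r : MvPolynomial (Fin 2) ℂ, (∀ j, r ∣ p j) → r ∣ q → IsUnit r := fun r h1 h2 => by
    refine isUnit_of_forall_dvd_of_zeros (ι := Fin n ⊕ Bool) (z₀ := z₀) (w₀ := w₀)
      (v := Sum.elim (fun i => cubic (f i)) fun b => cubic (if b then g else δ)) ?_ ?_ ?_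
    · intro R _ _ _ x hx
      exact hzero R x (fun i => hx (Sum.inl i)) (hx (Sum.inr true)) (hx (Sum.inr false))
    · exact ⟨Sum.inr false, fun h => by
        have := totalDegree_cubic hdeg
        simp only [Sum.elim_inr, Bool.false_eq_true, if_false] at h
        simp [h] at this⟩
    · rintro (i | _ | _)
      · have := h1 (Fin.castLE hn.le i)
        rw [hpi] at this
        exact (hunit _ (hs i)).dvd_mul_left.1 this
      · exact (hunit _ ht).dvd_mul_left.1 h2
      · have := h1 ⟨N - 1, by omega⟩
        rw [hpl] at this
        exact (hunit _ ht).dvd_mul_left.1 this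
  refine ⟨hmaps, ⟨p, q, hcop, hFq, ?_⟩, ?_⟩
  · rw [hqdeg]
    refine max_eq_right (Finset.sup_le fun j _ => ?_)
    simp only [hp]
    split_ifs
    · exact hdC _ _
    · exact hdC _ _
    · simp
  · rintro ⟨P, hP, -, hFP⟩
    obtain ⟨c, d, a, b, k, m, hk, hab, hm, hqm, heq⟩ :=
      exists_combination_eq_affine_pow hcop hFq hmaps hP hFP
    set c' : Fin n → ℂ := fun i => k⁻¹ * (c (Fin.castLE hn.le i) * s i) with hc'
    have hcomb : cubic (fun j => ∑ i, c' i * f i j + k⁻¹ * c ⟨N - 1, by omega⟩ * t * g j +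
        k⁻¹ * d * t * δ j) = (C a * X 0 + C b * X 1 + C 1) ^ m := by
      have h1 : (C a * X 0 + C b * X 1 + C 1 : MvPolynomial (Fin 2) ℂ) ^ m =
          C k⁻¹ * (∑ j, C (c j) * p j + C d * q) := by
        rw [heq, ← mul_assoc, ← C_mul, inv_mul_cancel₀ hk, C_1, one_mul]
      rw [h1, Fin.sum_eq_sum_castLE_add_last hn _ fun j h1 h2 => by simp [hp0 j h1 h2]]
      simp only [hpi, hpl, hq]
      refine funext fun x => ?_
      simp only [map_add, map_mul, map_sum, eval_C, eval_cubic, hc', mul_add, add_mul,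
        Finset.sum_add_distrib, Finset.mul_sum, Finset.sum_mul]
      simp only [mul_comm, mul_left_comm, mul_assoc]
      ring
    obtain ⟨n1, n2⟩ := hpow c' (k⁻¹ * c ⟨N - 1, by omega⟩ * t) (k⁻¹ * d * t) a b hab
    by_cases h0 : a = 0 ∧ b = 0
    · refine n1 (cubic_injective (hcomb.trans ?_))
      simp [cubic, hm h0]
    -- The exponent is at least `deg q = 3`, and a combination of cubics has degree at most 3.
    · have hm3 : m = 3 := by
        refine le_antisymm ?_ (hqdeg ▸ hqm h0)
        rw [← (affine_pow_totalDegree_and_irreducible h0 1 m).1, ← hcomb]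
        exact totalDegree_cubic_le _
      refine n2 (cubic_injective (hcomb.trans ?_))
      rw [hm3]
      refine funext fun x => ?_
      simp [eval_cubic]
      ring

/-! ### Verification for the three maps -/

theorem paddedQuotient_congr {N : ℕ} {f f' : List ℂ} {g g' δ δ' : ℂ} (hf : f = f') (hg : g = g')
    (hδ : δ = δ') : paddedQuotient N f g δ = paddedQuotient N f' g' δ' := by
  rw [hf, hg, hδ]

/-- The main theorem for the map `F²_N`. -/
theorem mapF2_conclusion {N : ℕ} (hN : 4 ≤ N) :
    Set.MapsTo (mapF2 N) (unitSphere 2) (unitSphere N) ∧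
    IsRationalOfDegree (mapF2 N) 3 ∧
    ¬ ∃ P : CSpace 2 → CSpace N, IsPolynomialMap P ∧
        Set.MapsTo P (unitSphere 2) (unitSphere N) ∧ SphereEquivalent (mapF2 N) P := by
  refine sphereMap_not_equivalent_polynomial (n := 3) (by omega)
    ![1, 2, (Real.sqrt 15 : ℝ) * Complex.I] ?_ 1 one_ne_zero
    ![![0, 4, 0, 0, -1, 0, 4, 0, 1, 0], ![0, 0, 1, 0, 0, -2, 0, 1, 0, 1],
      ![0, 0, 0, 0, 1, 0, 0, 0, -1, 0]] ![1, 0, 2, -1, 0, 1, 0, 5, 0, 0]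
    ![5, 0, -2, 3, 0, 1, 0, 1, 0, 0] ?_ ?_ 0 0 (by simp) ?_ ⟨7, by decide, by simp⟩ ?_
  · intro i
    fin_cases i <;> simp
  · intro Z
    refine paddedQuotient_congr ?_ ?_ ?_
    · simp only [eval_cubic, List.ofFn_succ, List.ofFn_zero, Matrix.cons_val_zero,
        Matrix.cons_val_succ, Matrix.cons_val, List.cons.injEq, and_true]
      refine ⟨?_, ?_, ?_⟩ <;> ring
    · simp only [eval_cubic, Matrix.cons_val]
      ring
    · simp only [eval_cubic, Matrix.cons_val]
      ring
  · intro x hx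
    have hx' : x 0 * starRingEnd ℂ (x 0) + x 1 * starRingEnd ℂ (x 1) = 1 := by
      rw [Complex.mul_conj', Complex.mul_conj']
      exact_mod_cast hx
    have h15 : ‖((Real.sqrt 15 : ℝ) * Complex.I : ℂ)‖ ^ 2 = 15 := by
      simp
    simp only [Fin.sum_univ_three, Matrix.cons_val, h15, norm_one, Complex.norm_ofNat]
    rw [← Complex.ofReal_inj]
    push_cast
    simp only [← Complex.mul_conj', eval_cubic, Matrix.cons_val, map_add, map_mul, map_pow,
      map_ofNat, map_neg, map_zero, map_one]
    -- With the conjugates as independent variables, the difference of the two sides is divisible by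
    -- `z z' + w w' - 1`; the polynomial below is the quotient.
    generalize starRingEnd ℂ (x 0) = z' at *
    generalize starRingEnd ℂ (x 1) = w' at *
    generalize x 0 = z at *
    generalize x 1 = w at *
    linear_combination (24 - 12*w' + 4*w'^2 + 16*z'^2 - 12*w + 20*w*w' - 8*w*w'^2 - 4*w*z'^2 + 4*w^2 - 8*w^2*w'
      + 4*w^2*w'^2 + 4*w^2*z'^2 + 8*z*z' - 8*z*z'*w' - 8*z*w*z' + 12*z*w*z'*w' + 16*z^2 - 4*z^2*w'
      + 4*z^2*w'^2 + 16*z^2*z'^2) * hx'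
  · intro R _ _ _ x hf hg hδ
    -- There is no common zero at all; `(0, 0)` only served as some point off the sphere.
    exfalso
    have : CharZero R := charZero_of_injective_algebraMap (algebraMap ℂ R).injective
    have h2 := hf 1
    have h3 := hf 2
    simp only [aeval_cubic, Matrix.cons_val, map_zero, map_one, map_neg, map_ofNat] at h2 h3 hg hδ
    generalize x 0 = z at *
    generalize x 1 = w at *
    have h4 : z * w * (w - 1) = 0 := by linear_combination -h3
    rcases mul_eq_zero.1 h4 with h5 | h5
    · rcases mul_eq_zero.1 h5 with rfl | rfl
      · have h6 : w * (w - 1) ^ 2 = 0 := by linear_combination h2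
        rcases mul_eq_zero.1 h6 with rfl | h7
        · norm_num at hδ
        · obtain rfl := sub_eq_zero.1 (pow_eq_zero_iff two_ne_zero |>.1 h7)
          norm_num at hδ
      · have : (8 : R) = 0 := by linear_combination hδ + 3 * hg
        norm_num at this
    · obtain rfl := sub_eq_zero.1 h5
      have : (4 : R) = 0 := by linear_combination hδ - 4 * h2
      norm_num at this
  · intro c d e a b hab
    refine ⟨fun h => ?_, fun h => ?_⟩
    all_goals
      have e0 := congrFun h 0
      have e1 := congrFun h 1
      have e2 := congrFun h 2
      have e3 := congrFun h 3
      have e4 := congrFun h 4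
      have e5 := congrFun h 5
      have e6 := congrFun h 6
      have e7 := congrFun h 7
      have e8 := congrFun h 8
      have e9 := congrFun h 9
      simp only [Fin.sum_univ_three, Matrix.cons_val] at e0 e1 e2 e3 e4 e5 e6 e7 e8 e9
      clear h
    · grind
    -- Only the first component contains `z` and `z³`, with equal coefficients, so `3a = a³`. For `a
    -- = 0` the linear equations force both `b = -1/2` and `b³ = -2`; `a² = 3` violates `|a| < 1`.
    · have ha : a * (a ^ 2 - 3) = 0 := by linear_combination e1 - e6
      rcases mul_eq_zero.1 ha with rfl | ha
      · grind
      · have h1 : ‖a‖ ^ 2 = 3 := by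
          rw [← norm_pow, sub_eq_zero.1 ha, Complex.norm_ofNat]
        nlinarith [sq_nonneg ‖b‖]

/-- The main theorem for the map `F¹_N` with `N ≥ 5`. -/
theorem mapF1Large_conclusion {N : ℕ} (hN : 5 ≤ N) :
    Set.MapsTo (mapF1Large N) (unitSphere 2) (unitSphere N) ∧
    IsRationalOfDegree (mapF1Large N) 3 ∧
    ¬ ∃ P : CSpace 2 → CSpace N, IsPolynomialMap P ∧
        Set.MapsTo P (unitSphere 2) (unitSphere N) ∧ SphereEquivalent (mapF1Large N) P := by
  refine sphereMap_not_equivalent_polynomial (n := 4) (by omega)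
    ![2 * (Real.sqrt 5 : ℝ), 4 * (Real.sqrt 5 : ℝ), 2 * Complex.I, -4] ?_
    (Real.sqrt 5 : ℝ) (by simp)
    ![![-1, 1, 1, -2, 8, 1, 0, 2, -1, -1], ![0, 0, 0, 1, 0, 0, 2, 1, 0, 0],
      ![-1, 3, 1, 10, 4, 1, 0, -10, -7, -1], ![1, 2, -1, 0, -4, -1, 0, 0, 2, 1]]
    ![9, 6, -9, 0, -8, 15, 0, 0, 2, 1]
    ![17, 6, -9, 0, -8, 7, 0, 0, 2, 1] ?_ ?_ 0 0 (by simp) ?_ ⟨9, by decide, by simp⟩ ?_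
  · intro i
    fin_cases i <;> simp
  · intro Z
    refine paddedQuotient_congr ?_ ?_ ?_
    · simp only [eval_cubic, List.ofFn_succ, List.ofFn_zero, Matrix.cons_val_zero,
        Matrix.cons_val_succ, Matrix.cons_val, List.cons.injEq, and_true]
      refine ⟨?_, ?_, ?_, ?_⟩ <;> ring
    · simp only [eval_cubic, Matrix.cons_val]
      ring
    · simp only [eval_cubic, Matrix.cons_val]
      ring
  · intro x hx
    have hx' : x 0 * starRingEnd ℂ (x 0) + x 1 * starRingEnd ℂ (x 1) = 1 := by
      rw [Complex.mul_conj', Complex.mul_conj']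
      exact_mod_cast hx
    have h5 : ‖((Real.sqrt 5 : ℝ) : ℂ)‖ ^ 2 = 5 := by
      simp
    simp only [Fin.sum_univ_four, Matrix.cons_val, norm_mul, mul_pow, h5, Complex.norm_I, norm_neg,
      Complex.norm_ofNat]
    rw [← Complex.ofReal_inj]
    push_cast
    simp only [← Complex.mul_conj', eval_cubic, Matrix.cons_val, map_add, map_mul, map_pow,
      map_ofNat, map_neg, map_zero, map_one]
    generalize starRingEnd ℂ (x 0) = z' at *
    generalize starRingEnd ℂ (x 1) = w' at *
    generalize x 0 = z at *
    generalize x 1 = w at *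
    linear_combination (1000 - 320*w' - 40*w'^2 + 240*z' - 80*z'*w' - 320*w + 960*w*w' - 40*w^2 + 40*w^2*w'^2
      - 240*w^2*z' + 80*w^2*z'*w' + 240*z - 240*z*w'^2 + 880*z*z' - 400*z*z'*w' + 160*z*z'^2
      - 80*z*w + 80*z*w*w'^2 - 400*z*w*z' + 240*z*w*z'*w' + 160*z*w*z'^2 + 160*z^2*z'
      + 160*z^2*z'*w' + 320*z^2*z'^2) * hx'
  · intro R _ _ _ x hf hg hδ
    exfalso
    have : CharZero R := charZero_of_injective_algebraMap (algebraMap ℂ R).injective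
    have h1 := hf 0
    have h2 := hf 1
    have h3 := hf 2
    have h4 := hf 3
    clear hf
    simp only [aeval_cubic, Matrix.cons_val, map_zero, map_one, map_neg, map_ofNat] at h1 h2 h3 h4 hg hδ
    generalize x 0 = z at *
    generalize x 1 = w at *
    have h5 : z ^ 2 * (w + 2 * z + 1) = 0 := by linear_combination h2
    have h6 : z = 0 := by
      rcases mul_eq_zero.1 h5 with h7 | h7
      · exact pow_eq_zero_iff two_ne_zero |>.1 h7
      · obtain rfl : w = -1 - 2 * z := by linear_combination h7
        have h8 : 8 * z ^ 2 = 0 := by linear_combination -h1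
        simpa using h8
    subst h6
    have h7 : (w - 1) ^ 2 * (w + 1) = 0 := by linear_combination h4
    rcases mul_eq_zero.1 h7 with h8 | h8
    · obtain rfl := sub_eq_zero.1 (pow_eq_zero_iff two_ne_zero |>.1 h8)
      norm_num at hδ
    · obtain rfl := eq_neg_of_add_eq_zero_left h8
      norm_num at hδ
  · intro c d e a b hab
    refine ⟨fun h => ?_, fun h => ?_⟩
    all_goals
      have e0 := congrFun h 0
      have e1 := congrFun h 1
      have e2 := congrFun h 2
      have e3 := congrFun h 3
      have e4 := congrFun h 4
      have e5 := congrFun h 5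
      have e6 := congrFun h 6
      have e7 := congrFun h 7
      have e8 := congrFun h 8
      have e9 := congrFun h 9
      simp only [Fin.sum_univ_four, Matrix.cons_val] at e0 e1 e2 e3 e4 e5 e6 e7 e8 e9
      clear h
    · grind
    -- The first relation comes from `z²`, `z²w`, `z³`: in the span the first two coefficients add
    -- up to the third. The second comes from the pure powers of `w`, whose four coefficients depend
    -- on only three parameters.
    · have ha : a ^ 2 * (3 * b + 3 - a) = 0 := by grind
      have hb : 3 * b ^ 3 + 3 * b ^ 2 + 9 * b + 1 = 0 := by grind
      rcases mul_eq_zero.1 ha with ha | ha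
      · obtain rfl : a = 0 := by simpa using ha
        grind
      · obtain rfl : a = 3 * b + 3 := by linear_combination -ha
        -- Eliminating the combination from the coefficients of `z²`, `z³`, `zw²`, `w³` and
        -- inserting `a = 3b + 3` gives this cube.
        have h1 : (b + 3) ^ 3 = 0 := by grind
        have h2 : b = -3 := by
          have := pow_eq_zero_iff three_ne_zero |>.1 h1
          linear_combination this
        rw [h2] at hb
        norm_num at hb

/-- The main theorem for the map `F¹_4`. -/
theorem mapF1Four_conclusion :
    Set.MapsTo (mapF1Four) (unitSphere 2) (unitSphere 4) ∧
    IsRationalOfDegree (mapF1Four) 3 ∧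
    ¬ ∃ P : CSpace 2 → CSpace 4, IsPolynomialMap P ∧
        Set.MapsTo P (unitSphere 2) (unitSphere 4) ∧ SphereEquivalent (mapF1Four) P := by
  refine sphereMap_not_equivalent_polynomial (n := 3) (by omega)
    ![6, 36, -6 * Complex.I] ?_ 1 one_ne_zero
    ![![-3, 13, 3, -6, 40, 3, 0, 6, 19, -3], ![0, 0, 0, 3, 0, 0, 2, 3, 0, 0],
      ![3, -7, -3, -6, -4, -3, 0, 6, 11, 3]] ![25, 30, 111, 0, -24, 207, 0, 0, -6, 89]
    ![169, 30, 183, 0, -24, 63, 0, 0, -6, 17] ?_ ?_ (3 / 2) (-2) (by norm_num) ?_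
    ⟨9, by decide, by simp⟩ ?_
  · intro i
    fin_cases i <;> simp
  · intro Z
    refine paddedQuotient_congr ?_ ?_ ?_
    · simp only [eval_cubic, List.ofFn_succ, List.ofFn_zero, Matrix.cons_val_zero,
        Matrix.cons_val_succ, Matrix.cons_val, List.cons.injEq, and_true]
      refine ⟨?_, ?_, ?_⟩ <;> ring
    · simp only [eval_cubic, Matrix.cons_val]
      ring
    · simp only [eval_cubic, Matrix.cons_val]
      ring
  · intro x hx
    have hx' : x 0 * starRingEnd ℂ (x 0) + x 1 * starRingEnd ℂ (x 1) = 1 := by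
      rw [Complex.mul_conj', Complex.mul_conj']
      exact_mod_cast hx
    simp only [Fin.sum_univ_three, Matrix.cons_val, norm_mul, Complex.norm_I, norm_neg, norm_one,
      Complex.norm_ofNat]
    rw [← Complex.ofReal_inj]
    push_cast
    simp only [← Complex.mul_conj', eval_cubic, Matrix.cons_val, map_add, map_mul, map_pow,
      map_ofNat, map_neg, map_zero]
    generalize starRingEnd ℂ (x 0) = z' at *
    generalize starRingEnd ℂ (x 1) = w' at *
    generalize x 0 = z at *
    generalize x 1 = w at *
    linear_combination (27288 + 28800*w' + 6120*w'^2 + 6480*z' + 1296*z'*w' + 28800*w + 47808*w*w' + 16704*w*w'^2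
      + 6120*w^2 + 16704*w^2*w' + 8280*w^2*w'^2 - 6480*w^2*z' - 1296*w^2*z'*w' + 6480*z
      - 6480*z*w'^2 + 19440*z*z' + 9072*z*z'*w' + 7776*z*z'^2 + 1296*z*w - 1296*z*w*w'^2
      + 9072*z*w*z' + 9072*z*w*z'*w' + 7776*z*w*z'^2 + 7776*z^2*z' + 7776*z^2*z'*w'
      + 5184*z^2*z'^2) * hx'
  · intro R _ _ _ x hf hg hδ
    have : CharZero R := charZero_of_injective_algebraMap (algebraMap ℂ R).injective
    have h1 := hf 0
    have h2 := hf 1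
    have h3 := hf 2
    clear hf
    simp only [aeval_cubic, Matrix.cons_val, map_zero, map_neg, map_ofNat] at h1 h2 h3 hg hδ
    generalize x 0 = z at *
    generalize x 1 = w at *
    have hz : z ≠ 0 ∨ w ≠ -1 := by
      by_contra! h
      rw [h.1, h.2] at hδ
      norm_num at hδ
    have h5 : z ^ 2 * (3 * w + 2 * z + 3) = 0 := by linear_combination h2
    rcases mul_eq_zero.1 h5 with h7 | h7
    · obtain rfl : z = 0 := pow_eq_zero_iff two_ne_zero |>.1 h7
      have h8 : 3 * ((w - 1) ^ 2 * (w + 1)) = 0 := by linear_combination h3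
      rcases mul_eq_zero.1 ((mul_eq_zero.1 h8).resolve_left (by norm_num)) with h9 | h9
      · obtain rfl := sub_eq_zero.1 (pow_eq_zero_iff two_ne_zero |>.1 h9)
        norm_num at hδ
      · exact absurd (eq_neg_of_add_eq_zero_left h9) (by simpa using hz)
    -- This is the first component after substituting `2z = -3(w + 1)`. The root `w = -1` leads to
    -- `(0, -1)`, where the denominator is not zero; `w = -2` gives `(3/2, -2)`, a true common zero
    -- outside the closed ball.
    · have h8 : 36 * ((w + 1) ^ 2 * (w + 2)) = 0 := by
        linear_combination -2 * h1 + ((19 * w ^ 2 + 40 * w + 13)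
          + 3 * (w - 1) * (3 * w + 2 * z + 3 - 6 * (w + 1))) * h7
      rcases mul_eq_zero.1 ((mul_eq_zero.1 h8).resolve_left (by norm_num)) with h9 | h9
      · obtain rfl := eq_neg_of_add_eq_zero_left (pow_eq_zero_iff two_ne_zero |>.1 h9)
        have h10 : 2 * z = 0 := by linear_combination h7
        exact absurd (by simpa using h10) (by simpa using hz)
      · have hw := eq_neg_of_add_eq_zero_left h9
        have h10 : 2 * algebraMap ℂ R (3 / 2) = 3 := by
          rw [← map_ofNat (algebraMap ℂ R) 2, ← map_mul, mul_div_cancel₀ _ two_ne_zero, map_ofNat]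
        refine ⟨mul_left_cancel₀ (two_ne_zero (α := R)) ?_, by rw [hw, map_neg, map_ofNat]⟩
        rw [h10]
        linear_combination h7 - 3 * hw
  · intro c d e a b hab
    refine ⟨fun h => ?_, fun h => ?_⟩
    all_goals
      have e0 := congrFun h 0
      have e1 := congrFun h 1
      have e2 := congrFun h 2
      have e3 := congrFun h 3
      have e4 := congrFun h 4
      have e5 := congrFun h 5
      have e6 := congrFun h 6
      have e7 := congrFun h 7
      have e8 := congrFun h 8
      have e9 := congrFun h 9
      simp only [Fin.sum_univ_three, Matrix.cons_val] at e0 e1 e2 e3 e4 e5 e6 e7 e8 e9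
      clear h
    · grind
    -- Again one relation from `z²`, `z²w`, `z³` and one from the pure powers of `w`.
    · have ha : a ^ 2 * (b + 1 - a) = 0 := by grind
      have hb : 29 * b ^ 3 - 75 * b ^ 2 + 87 * b - 25 = 0 := by grind
      rcases mul_eq_zero.1 ha with ha | ha
      · obtain rfl : a = 0 := by simpa using ha
        grind
      · obtain rfl : a = b + 1 := by linear_combination -ha
        have h1 : (b + 1) * (b - 5) ^ 2 = 0 := by grind
        rcases mul_eq_zero.1 h1 with h2 | h2
        · obtain rfl := eq_neg_of_add_eq_zero_left h2
          norm_num at hb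
        · obtain rfl := sub_eq_zero.1 (pow_eq_zero_iff two_ne_zero |>.1 h2)
          norm_num at hb

theorem mainTheorem5 (N : ℕ) (hN : 4 ≤ N) (F : CSpace 2 → CSpace N)
    (hF : F = mapF1 N ∨ F = mapF2 N) :
    Set.MapsTo F (unitSphere 2) (unitSphere N) ∧
    IsRationalOfDegree F 3 ∧
    ¬ ∃ P : CSpace 2 → CSpace N, IsPolynomialMap P ∧
        Set.MapsTo P (unitSphere 2) (unitSphere N) ∧ SphereEquivalent F P := by
  rcases hF with rfl | rfl
  · rcases hN.eq_or_lt with rfl | h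
    · exact mapF1Four_conclusion
    · have : mapF1 N = mapF1Large N := by
        unfold mapF1
        split
        · omega
        · rfl
      rw [this]
      exact mapF1Large_conclusion h
  · exact mapF2_conclusion hN
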